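/- Let $\mathcal X=\mathbb R^H$, $\mathcal Y=\mathbb R^D$, let $\mu,\nu$ be Borel probability measures on $\mathcal X,\mathcal Y$, and let $Q:\mathcal X\to\mathcal Y$ be measurable, such that $Q_\#\mu$ and $\nu$ have finite second moments. Assume that there is a unique optimal transport plan between $Q_\#\mu$ and $\nu$ for the quadratic cost $\frac12\|x-y\|^2$ (a coupling minimizing $\int\frac12\|x-y\|^2\,d\pi(x,y)$ over all couplings $\pi\in\Pi(Q_\#\mu,\nu)$), and that it is deterministic, i.e. equal to $[\mathrm{id}_{\mathbb R^D},T^*]_\#(Q_\#\mu)$ for a measurable map $T^*:\mathbb R^D\to\mathbb R^D$. Put $G^*=T^*\circ Q$. (1) $G^*$ is the optimal transport map from $\mu$ to $\nu$ for the $Q$-embedded quadratic cost $c(x,y)=\frac12\|Q(x)-y\|^2$: $G^*_\#\mu=\nu$, and $G^*$ minimizes $\int\frac12\|Q(x)-G(x)\|^2\,d\mu(x)$ over all measurable $G:\mathcal X\to\mathcal Y$ with $G_\#\mu=\nu$; any other minimizer equals $G^*$ $\mu$-almost everywhere. (2) Call a Borel function $\psi:\mathcal Y\to(-\infty,+\infty]$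 with $\int|\psi|\,d\nu<\infty$ a potential, and consider the saddle point problem $$\inf_\psi\sup_G\Big\{\int_{\mathcal X}\big[\langle Q(x),G(x)\rangle-\psi(G(x))\big]\,d\mu(x)+\int_{\mathcal Y}\psi(y)\,d\nu(y)\Big\},$$ where the infimum is over real-valued potentials $\psi$ and the supremum over measurable maps $G:\mathcal X\to\mathcal Y$. Here $\int f\,d\mu=\int f^+d\mu-\int f^-d\mu\in[-\infty,+\infty]$, with the convention $\infty-\infty=-\infty$. A potential $\psi^*$, possibly with the value $+\infty$, is called optimal if the value of the supremum at $\psi^*$ is at most its value at every real-valued potential. Then, for every optimal potential $\psi^*$, $$G^*\in\operatorname*{arg\,sup}_{G}\int_{\mathcal X}\big[\langle Q(x),G(x)\rangle-\psi^*(G(x))\big]\,d\mu(x),$$ the supremum being over all measurable maps $G:\mathcal X\to\mathcal Y$, and this maximum is finite. -/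

import Mathlib

open MeasureTheory
open scoped ENNReal

namespace EmbeddedOT

section Transport

variable {X Y : Type*} [MeasurableSpace X] [MeasurableSpace Y]

/-- The set `Π(μ, ν)` of couplings: measures on the product with marginals `μ` and `ν`. -/
def couplings (μ : Measure X) (ν : Measure Y) : Set (Measure (X × Y)) :=
  {π | π.fst = μ ∧ π.snd = ν}

/-- `π` is an optimal transport plan between `μ` and `ν` for the nonnegative cost `c`:
a coupling attaining the infimum in Kantorovich's problem. -/
def IsOTPlan (c : X → Y → ℝ≥0∞) (μ : Measure X) (ν : Measure Y) (π : Measure (X × Y)) : Prop :=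
  π ∈ couplings μ ν ∧
    ∀ π' ∈ couplings μ ν, ∫⁻ p, c p.1 p.2 ∂π ≤ ∫⁻ p, c p.1 p.2 ∂π'

/-- `T` is an optimal transport map from `μ` to `ν` for the nonnegative cost `c`:
a measurable map pushing `μ` to `ν` and attaining the infimum in Monge's problem. -/
def IsOTMap (c : X → Y → ℝ≥0∞) (μ : Measure X) (ν : Measure Y) (T : X → Y) : Prop :=
  (Measurable T ∧ μ.map T = ν) ∧
    ∀ S : X → Y, Measurable S → μ.map S = ν →
      ∫⁻ x, c x (T x) ∂μ ≤ ∫⁻ x, c x (S x) ∂μ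

end Transport

/-- The quadratic cost `½‖x - y‖²`. -/
noncomputable def quadraticCost {D : ℕ} (x y : EuclideanSpace ℝ (Fin D)) : ℝ≥0∞ :=
  ENNReal.ofReal (1 / 2 * ‖x - y‖ ^ 2)

/-- The `Q`-embedded quadratic cost `½‖Q(x) - y‖²`. -/
noncomputable def embeddedQuadraticCost {H D : ℕ}
    (Q : EuclideanSpace ℝ (Fin H) → EuclideanSpace ℝ (Fin D))
    (x : EuclideanSpace ℝ (Fin H)) (y : EuclideanSpace ℝ (Fin D)) : ℝ≥0∞ :=
  ENNReal.ofReal (1 / 2 * ‖Q x - y‖ ^ 2)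

/-- The integral `∫ f⁺ dμ - ∫ f⁻ dμ` of an extended real function, with values in `[-∞, ∞]`.
In `EReal`, `∞ - ∞ = -∞`, the usual convention for integrals that are to be maximized. For an
integrable function it is the ordinary integral. -/
noncomputable def extIntegral {X : Type*} [MeasurableSpace X] (μ : Measure X) (f : X → EReal) :
    EReal :=
  ((∫⁻ x, (f x).toENNReal ∂μ : ℝ≥0∞) : EReal) - ((∫⁻ x, (-f x).toENNReal ∂μ : ℝ≥0∞) : EReal)

/-- A potential: a Borel function with values in `(-∞, ∞]` that is integrable for `ν`
(in particular, finite `ν`-almost everywhere). -/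
def IsPotential {D : ℕ} (ν : Measure (EuclideanSpace ℝ (Fin D)))
    (ψ : EuclideanSpace ℝ (Fin D) → EReal) : Prop :=
  Measurable ψ ∧ (∀ y, ψ y ≠ ⊥) ∧ ∫⁻ y, (ψ y).abs ∂ν ≠ ⊤

/-- The functional `∫ (⟨Q(x), G(x)⟩ - ψ(G(x))) dμ(x)` of the inner maximization. -/
noncomputable def innerFunctional {H D : ℕ}
    (Q : EuclideanSpace ℝ (Fin H) → EuclideanSpace ℝ (Fin D))
    (μ : Measure (EuclideanSpace ℝ (Fin H)))
    (ψ : EuclideanSpace ℝ (Fin D) → EReal)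
    (G : EuclideanSpace ℝ (Fin H) → EuclideanSpace ℝ (Fin D)) : EReal :=
  extIntegral μ fun x => ((inner ℝ (Q x) (G x) : ℝ) : EReal) - ψ (G x)

/-- The outer objective
`sup_G { ∫ (⟨Q(x), G(x)⟩ - ψ(G(x))) dμ(x) + ∫ ψ dν }` of the saddle point problem, the supremum
being over all measurable maps `G`. -/
noncomputable def outerObjective {H D : ℕ}
    (Q : EuclideanSpace ℝ (Fin H) → EuclideanSpace ℝ (Fin D))
    (μ : Measure (EuclideanSpace ℝ (Fin H))) (ν : Measure (EuclideanSpace ℝ (Fin D)))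
    (ψ : EuclideanSpace ℝ (Fin D) → EReal) : EReal :=
  ⨆ (G : EuclideanSpace ℝ (Fin H) → EuclideanSpace ℝ (Fin D)) (_ : Measurable G),
    (innerFunctional Q μ ψ G + extIntegral ν ψ)

/-- `ψ` is an optimal potential of the saddle point problem `inf_ψ sup_G`. The infimum is over
real-valued potentials. The optimal potential itself may also take the value `∞`, since the
infimum need not be attained by a real-valued one (for instance if `Q_# μ` is Gaussian and `ν` has
compact support). A real-valued potential is optimal in this sense iff it is a minimizer among the
real-valued ones, and a minimizer among all `(-∞, ∞]`-valued potentials is optimal in this sense. -/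
def IsOptimalPotential {H D : ℕ}
    (Q : EuclideanSpace ℝ (Fin H) → EuclideanSpace ℝ (Fin D))
    (μ : Measure (EuclideanSpace ℝ (Fin H))) (ν : Measure (EuclideanSpace ℝ (Fin D)))
    (ψ : EuclideanSpace ℝ (Fin D) → EReal) : Prop :=
  IsPotential ν ψ ∧
    ∀ φ : EuclideanSpace ℝ (Fin D) → ℝ, IsPotential ν (fun y => (φ y : EReal)) →
      outerObjective Q μ ν ψ ≤ outerObjective Q μ ν (fun y => (φ y : EReal))

end EmbeddedOT

/-! Part (1): a map `G` with `μ.map G = ν` yields the coupling `(Q, G)_# μ` of `Q_# μ` and `ν`, of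
the same cost. The optimal plan is the one given by `T ∘ Q`, so `T ∘ Q` is optimal; any other
minimizer yields an optimal plan too, which by uniqueness lives on the graph of `T`
(`isOTMap_comp`).

Part (2) is Kantorovich duality. Let `C` be the integral of `⟪x, y⟫` against the optimal plan. Its
support is cyclically monotone, so Rockafellar's potential and its conjugate satisfy Fenchel–Young
with equality there, and their integrals add up to `C` (`exists_dual_potentials`). Hence the
objective at an optimal `ψ` is at most `C` (`IsOptimalPotential.outerObjective_le`). Since `T ∘ Q`
pushes `μ` to `ν`, the terms in `ψ` cancel and it attains exactly `C` (`innerFunctional_of_map_eq`),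
so no `G` does better.

The obstacle is that the conjugate may be infinite on a `ν`-null set, while optimality of `ψ` is
tested only against real-valued potentials. There it is replaced by `k‖y‖² + k`, at a cost that
vanishes as `k → ∞`. -/

namespace EmbeddedOT

open Filter Topology ProbabilityTheory

/-! ### Optimal plans have cyclically monotone support -/

section CyclicalMonotonicity

/-- Exchanging small pieces of mass: if finitely many conditional measures of `π` are replaced by
products of their marginals, matched according to a permutation, the result is again a coupling.
Hence for an optimal plan the total cost of the pieces does not decrease. -/
theorem IsOTPlan.sum_lintegral_cond_le {X Y : Type*} [MeasurableSpace X] [MeasurableSpace Y]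
    {c : X → Y → ℝ≥0∞}
    {μ : Measure X} {ν : Measure Y} {π : Measure (X × Y)} [IsFiniteMeasure π]
    (hπ : IsOTPlan c μ ν π) (hcost : ∫⁻ p, c p.1 p.2 ∂π ≠ ⊤)
    {ι : Type*} [Fintype ι] (B : ι → Set (X × Y)) (hB : ∀ i, π (B i) ≠ 0) (σ : Equiv.Perm ι) :
    ∑ i, ∫⁻ p, c p.1 p.2 ∂(π[|B i]) ≤
      ∑ i, ∫⁻ p, c p.1 p.2 ∂((π[|B (σ i)]).fst.prod (π[|B i]).snd) := by
  classical
  rcases isEmpty_or_nonempty ι with hι | ⟨⟨i₀⟩⟩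
  · simp
  have hprob : ∀ i, IsProbabilityMeasure (π[|B i]) := fun i => cond_isProbabilityMeasure (hB i)
  -- Each `π[|B i]` is at most `(π (B i))⁻¹ • π`, so dividing their sum by `S` gives a measure below
  -- `π`, even if the sets overlap.
  set S : ℝ≥0∞ := ∑ i, (π (B i))⁻¹ with hS
  have hS0 : S ≠ 0 := by
    intro h
    have := (Finset.sum_eq_zero_iff.1 h) i₀ (Finset.mem_univ _)
    exact measure_ne_top π (B i₀) (ENNReal.inv_eq_zero.1 this)
  have hST : S ≠ ⊤ := ENNReal.sum_ne_top.2 fun i _ => ENNReal.inv_ne_top.2 (hB i)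
  set τ : Measure (X × Y) := S⁻¹ • ∑ i, π[|B i] with hτ
  set τ' : Measure (X × Y) := S⁻¹ • ∑ i, (π[|B (σ i)]).fst.prod (π[|B i]).snd with hτ'
  have hτπ : τ ≤ π := by
    refine Measure.le_iff'.2 fun s => ?_
    have h1 : ∀ i, π[|B i] s ≤ (π (B i))⁻¹ * π s := by
      intro i
      simp only [ProbabilityTheory.cond, Measure.smul_apply, smul_eq_mul]
      gcongr
      exact Measure.restrict_le_self
    calc τ s = S⁻¹ * ∑ i, π[|B i] s := by simp [hτ, Measure.finsetSum_apply]
      _ ≤ S⁻¹ * ∑ i, (π (B i))⁻¹ * π s := by gcongr with i; exact h1 i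
      _ = (S⁻¹ * S) * π s := by rw [← Finset.sum_mul, mul_assoc]
      _ = π s := by rw [ENNReal.inv_mul_cancel hS0 hST, one_mul]
  have : IsFiniteMeasure τ := isFiniteMeasure_of_le π hτπ
  have hsplit : (π - τ) + τ = π := Measure.sub_add_cancel_of_le hτπ
  have hfst : τ'.fst = τ.fst := by
    simp only [hτ, hτ', Measure.fst, Measure.map_smul,
      Measure.map_finset_sum measurable_fst.aemeasurable]
    congr 1
    rw [← Equiv.sum_comp σ fun i => (π[|B i]).map Prod.fst]
    refine Finset.sum_congr rfl fun i _ => ?_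
    exact Measure.fst_prod
  have hsnd : τ'.snd = τ.snd := by
    simp only [hτ, hτ', Measure.snd, Measure.map_smul,
      Measure.map_finset_sum measurable_snd.aemeasurable]
    congr 1
    refine Finset.sum_congr rfl fun i _ => ?_
    exact Measure.snd_prod
  have hcoup : (π - τ) + τ' ∈ couplings μ ν := by
    constructor
    · rw [← hπ.1.1, ← hsplit]
      simp only [Measure.fst, Measure.map_add _ _ measurable_fst] at hfst ⊢
      rw [hsplit, hfst]
    · rw [← hπ.1.2, ← hsplit]
      simp only [Measure.snd, Measure.map_add _ _ measurable_snd] at hsnd ⊢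
      rw [hsplit, hsnd]
  have hle := hπ.2 _ hcoup
  -- The untouched mass `π - τ` occurs on both sides; its cost can be cancelled because it is
  -- finite.
  have hne : ∫⁻ p, c p.1 p.2 ∂(π - τ) ≠ ⊤ := by
    refine ne_top_of_le_ne_top hcost ?_
    exact lintegral_mono' Measure.sub_le le_rfl
  conv_lhs at hle => rw [← hsplit]
  rw [lintegral_add_measure, lintegral_add_measure] at hle
  have hle' := (ENNReal.add_le_add_iff_left hne).1 hle
  simp only [hτ, hτ', lintegral_smul_measure, lintegral_finsetSum_measure, smul_eq_mul] at hle'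
  exact (ENNReal.mul_le_mul_iff_right (ENNReal.inv_ne_zero.2 hST) (ENNReal.inv_ne_top.2 hS0)).1 hle'

/-- The support of an optimal transport plan of finite cost is cyclically monotone. -/
theorem IsOTPlan.sum_le_sum_perm {X Y : Type*} [PseudoMetricSpace X] [PseudoMetricSpace Y]
    [SecondCountableTopology X] [SecondCountableTopology Y]
    [MeasurableSpace X] [MeasurableSpace Y] [BorelSpace X] [BorelSpace Y]
    {c : X → Y → ℝ≥0∞} (hc : Continuous fun p : X × Y => c p.1 p.2) (hfin : ∀ x y, c x y ≠ ⊤)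
    {μ : Measure X} {ν : Measure Y} {π : Measure (X × Y)} [IsFiniteMeasure π]
    (hπ : IsOTPlan c μ ν π) (hcost : ∫⁻ p, c p.1 p.2 ∂π ≠ ⊤)
    {ι : Type*} [Fintype ι] (p : ι → X × Y) (hp : ∀ i, p i ∈ π.support) (σ : Equiv.Perm ι) :
    ∑ i, c (p i).1 (p i).2 ≤ ∑ i, c (p (σ i)).1 (p i).2 := by
  refine ENNReal.le_of_forall_pos_le_add fun ε hε _ => ?_
  -- Each index loses `δ` twice: once at the original pair and once at the exchanged pair.
  obtain ⟨δ, hδ, hδε⟩ : ∃ δ : ℝ≥0∞, 0 < δ ∧ (Fintype.card ι : ℝ≥0∞) * (2 * δ) ≤ ε := by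
    refine ⟨ε / (2 * (Fintype.card ι + 1)), ?_, ?_⟩
    · refine ENNReal.div_pos (by simpa using hε.ne') ?_
      exact ENNReal.mul_ne_top (by simp) (by simp)
    · calc (Fintype.card ι : ℝ≥0∞) * (2 * (ε / (2 * (Fintype.card ι + 1))))
          ≤ (2 * (Fintype.card ι + 1)) * (ε / (2 * (Fintype.card ι + 1))) := by
            rw [← mul_assoc, mul_comm _ (2 : ℝ≥0∞)]
            gcongr
            exact le_self_add
        _ ≤ ε := ENNReal.mul_div_le
  have hball : ∀ (q : X × Y) (s : Set (X × Y)), s ∈ 𝓝 q →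
      ∀ᶠ r in 𝓝[>] (0 : ℝ), Metric.ball q r ⊆ s := by
    intro q s hs
    obtain ⟨r₀, hr₀, hsub⟩ := Metric.mem_nhds_iff.1 hs
    filter_upwards [Ioo_mem_nhdsGT hr₀] with r hr
    exact (Metric.ball_subset_ball hr.2.le).trans hsub
  have hlow : ∀ i, ∀ᶠ r in 𝓝[>] (0 : ℝ),
      Metric.ball (p i) r ⊆ {q | c (p i).1 (p i).2 < c q.1 q.2 + δ} := fun i =>
    hball _ _ ((hc.add continuous_const).continuousAt.eventually
      (lt_mem_nhds (ENNReal.lt_add_right (hfin _ _) hδ.ne')))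
  have hupp : ∀ i, ∀ᶠ r in 𝓝[>] (0 : ℝ), Metric.ball ((p (σ i)).1, (p i).2) r ⊆
      {q | c q.1 q.2 < c (p (σ i)).1 (p i).2 + δ} := fun i =>
    hball _ _ (hc.continuousAt.eventually
      (gt_mem_nhds (ENNReal.lt_add_right (hfin _ _) hδ.ne')))
  obtain ⟨r, hr, hr0⟩ := (((eventually_all.2 hlow).and (eventually_all.2 hupp)).and
    self_mem_nhdsWithin).exists
  obtain ⟨hl, hu⟩ := hr
  have hr0 : 0 < r := hr0
  have hB : ∀ i, π (Metric.ball (p i) r) ≠ 0 := fun i =>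
    ((Measure.mem_support_iff_forall (μ := π) _).1 (hp i) _ (Metric.ball_mem_nhds _ hr0)).ne'
  have hprob : ∀ i, IsProbabilityMeasure (π[|Metric.ball (p i) r]) :=
    fun i => cond_isProbabilityMeasure (hB i)
  have hmem : ∀ i, ∀ᵐ q ∂(π[|Metric.ball (p i) r]), q ∈ Metric.ball (p i) r := fun i =>
    ae_cond_mem Metric.isOpen_ball.measurableSet
  have key := hπ.sum_lintegral_cond_le hcost _ hB σ
  have h1 : ∀ i, c (p i).1 (p i).2 ≤ ∫⁻ q, c q.1 q.2 ∂(π[|Metric.ball (p i) r]) + δ := by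
    intro i
    calc c (p i).1 (p i).2 = ∫⁻ _, c (p i).1 (p i).2 ∂(π[|Metric.ball (p i) r]) := by simp
      _ ≤ ∫⁻ q, (c q.1 q.2 + δ) ∂(π[|Metric.ball (p i) r]) := by
        refine lintegral_mono_ae ?_
        filter_upwards [hmem i] with q hq
        exact (hl i hq).le
      _ = _ := by rw [lintegral_add_right _ measurable_const]; simp
  have h2 : ∀ i, ∫⁻ q, c q.1 q.2 ∂((π[|Metric.ball (p (σ i)) r]).fst.prod
      (π[|Metric.ball (p i) r]).snd) ≤ c (p (σ i)).1 (p i).2 + δ := by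
    intro i
    -- Balls of the product metric are products of balls, so the marginals stay close to the
    -- coordinates of the centres.
    have hx : ∀ᵐ x ∂(π[|Metric.ball (p (σ i)) r]).fst, x ∈ Metric.ball (p (σ i)).1 r := by
      refine (ae_map_iff measurable_fst.aemeasurable Metric.isOpen_ball.measurableSet).2 ?_
      filter_upwards [hmem (σ i)] with q hq
      rw [← ball_prod_same] at hq
      exact hq.1
    have hy : ∀ᵐ y ∂(π[|Metric.ball (p i) r]).snd, y ∈ Metric.ball (p i).2 r := by
      refine (ae_map_iff measurable_snd.aemeasurable Metric.isOpen_ball.measurableSet).2 ?_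
      filter_upwards [hmem i] with q hq
      rw [← ball_prod_same] at hq
      exact hq.2
    calc _ ≤ ∫⁻ _, (c (p (σ i)).1 (p i).2 + δ) ∂((π[|Metric.ball (p (σ i)) r]).fst.prod
          (π[|Metric.ball (p i) r]).snd) := by
          refine lintegral_mono_ae ?_
          filter_upwards [Measure.quasiMeasurePreserving_fst.ae hx,
            Measure.quasiMeasurePreserving_snd.ae hy] with q hq1 hq2
          have hq : q ∈ Metric.ball ((p (σ i)).1, (p i).2) r := by
            rw [← ball_prod_same]
            exact ⟨hq1, hq2⟩
          exact (hu i hq).le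
      _ = _ := by simp
  calc ∑ i, c (p i).1 (p i).2
      ≤ ∑ i, (∫⁻ q, c q.1 q.2 ∂(π[|Metric.ball (p i) r]) + δ) := Finset.sum_le_sum fun i _ => h1 i
    _ ≤ (∑ i, (c (p (σ i)).1 (p i).2 + δ)) + ∑ _i : ι, δ := by
        rw [Finset.sum_add_distrib]
        refine add_le_add ?_ le_rfl
        exact key.trans (Finset.sum_le_sum fun i _ => h2 i)
    _ = ∑ i, c (p (σ i)).1 (p i).2 + (Fintype.card ι : ℝ≥0∞) * (2 * δ) := by
        rw [Finset.sum_add_distrib, add_assoc]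
        simp only [Finset.sum_const, Finset.card_univ, nsmul_eq_mul]
        ring
    _ ≤ _ := by gcongr

end CyclicalMonotonicity

/-! ### Rockafellar's potential and its conjugate -/

section Rockafellar

variable {E : Type*} [NormedAddCommGroup E] [InnerProductSpace ℝ E]

/-- A set of pairs is cyclically monotone if `∑ ⟪x (i+1) - x i, y i⟫ ≤ 0` for every finite cycle
`(x 0, y 0), …, (x n, y n)` in it. -/
def CyclicallyMonotone (Γ : Set (E × E)) : Prop :=
  ∀ (n : ℕ) (q : ℕ → E × E), (∀ i, q i ∈ Γ) →
    ∑ i ∈ Finset.range n, inner ℝ ((q (i + 1)).1 - (q i).1) (q i).2 +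
      inner ℝ ((q 0).1 - (q n).1) (q n).2 ≤ 0

/-- Rockafellar's potential of a set `Γ` based at `p₀`. -/
noncomputable def rockafellar (Γ : Set (E × E)) (p₀ : E × E) (x : E) : EReal :=
  ⨆ (n : ℕ) (q : ℕ → E × E) (_ : (∀ i, q i ∈ Γ) ∧ q 0 = p₀),
    ((∑ i ∈ Finset.range n, inner ℝ ((q (i + 1)).1 - (q i).1) (q i).2 +
      inner ℝ (x - (q n).1) (q n).2 : ℝ) : EReal)

/-- The Legendre–Fenchel conjugate of an extended real function. -/
noncomputable def conjugate (f : E → EReal) (y : E) : EReal :=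
  ⨆ x : E, ((inner ℝ x y : ℝ) : EReal) - f x

/-- The chain consisting of `p₀` alone gives an affine minorant, later the lower bound for
integrability. -/
theorem le_rockafellar {Γ : Set (E × E)} {p₀ : E × E} (hp₀ : p₀ ∈ Γ) (x : E) :
    ((inner ℝ (x - p₀.1) p₀.2 : ℝ) : EReal) ≤ rockafellar Γ p₀ x := by
  refine le_trans ?_ (le_iSup₂_of_le 0 (fun _ => p₀) (le_iSup_of_le ⟨fun _ => hp₀, rfl⟩ le_rfl))
  simp

theorem rockafellar_ne_bot {Γ : Set (E × E)} {p₀ : E × E} (hp₀ : p₀ ∈ Γ) (x : E) :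
    rockafellar Γ p₀ x ≠ ⊥ :=
  ne_bot_of_le_ne_bot (EReal.coe_ne_bot _) (le_rockafellar hp₀ x)

/-- A chain evaluated at its own starting point closes up to a cycle. -/
theorem CyclicallyMonotone.rockafellar_base_le {Γ : Set (E × E)} (hΓ : CyclicallyMonotone Γ)
    (p₀ : E × E) : rockafellar Γ p₀ p₀.1 ≤ 0 := by
  refine iSup₂_le fun n q => iSup_le fun hq => ?_
  have := hΓ n q hq.1
  rw [hq.2] at this
  exact_mod_cast this

/-- Every pair in `Γ` gives a subgradient of the Rockafellar potential. -/
theorem rockafellar_add_inner_le {Γ : Set (E × E)} {p₀ p : E × E} (hp : p ∈ Γ) (z : E) :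
    rockafellar Γ p₀ p.1 + ((inner ℝ (z - p.1) p.2 : ℝ) : EReal) ≤ rockafellar Γ p₀ z := by
  rw [← EReal.le_sub_iff_add_le (Or.inl (EReal.coe_ne_bot _)) (Or.inl (EReal.coe_ne_top _))]
  refine iSup₂_le fun n q => iSup_le fun hq => ?_
  rw [EReal.le_sub_iff_add_le (Or.inl (EReal.coe_ne_bot _)) (Or.inl (EReal.coe_ne_top _))]
  -- The chain is prolonged by `p` as its last link; the new final term is the subgradient
  -- increment.
  let q' : ℕ → E × E := fun i => if i ≤ n then q i else p
  have hq' : (∀ i, q' i ∈ Γ) ∧ q' 0 = p₀ := by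
    refine ⟨fun i => ?_, by simpa [q'] using hq.2⟩
    by_cases h : i ≤ n
    · simpa [q', h] using hq.1 i
    · simpa [q', h] using hp
  refine le_trans (le_of_eq ?_) (le_iSup₂_of_le (n + 1) q' (le_iSup_of_le hq' le_rfl))
  rw [← EReal.coe_add, Finset.sum_range_succ]
  have h1 : ∑ i ∈ Finset.range n, inner ℝ ((q' (i + 1)).1 - (q' i).1) (q' i).2 =
      ∑ i ∈ Finset.range n, inner ℝ ((q (i + 1)).1 - (q i).1) (q i).2 := by
    refine Finset.sum_congr rfl fun i hi => ?_
    have hi := Finset.mem_range.1 hi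
    simp [q', hi.le, Nat.succ_le_of_lt hi]
  rw [h1]
  simp [q']

/-- An infinite value at `p.1` would propagate along the subgradient inequality to the base point,
where the potential is at most `0`. -/
theorem CyclicallyMonotone.rockafellar_ne_top {Γ : Set (E × E)} (hΓ : CyclicallyMonotone Γ)
    {p₀ p : E × E} (hp : p ∈ Γ) : rockafellar Γ p₀ p.1 ≠ ⊤ := by
  intro h
  have := (rockafellar_add_inner_le (p₀ := p₀) hp p₀.1).trans (hΓ.rockafellar_base_le p₀)
  rw [h, EReal.top_add_coe] at this
  exact absurd this (by simp)

/-- On a cyclically monotone set, the Rockafellar potential and its conjugate satisfy equality in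
the Fenchel–Young inequality. -/
theorem CyclicallyMonotone.conjugate_rockafellar {Γ : Set (E × E)} (hΓ : CyclicallyMonotone Γ)
    {p₀ p : E × E} (hp₀ : p₀ ∈ Γ) (hp : p ∈ Γ) :
    conjugate (rockafellar Γ p₀) p.2 =
      (((inner ℝ p.1 p.2 : ℝ) - (rockafellar Γ p₀ p.1).toReal : ℝ) : EReal) := by
  have hfin : ((rockafellar Γ p₀ p.1).toReal : EReal) = rockafellar Γ p₀ p.1 :=
    EReal.coe_toReal (hΓ.rockafellar_ne_top hp) (rockafellar_ne_bot hp₀ _)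
  refine le_antisymm (iSup_le fun z => ?_) (le_iSup_of_le p.1 ?_)
  · have h := rockafellar_add_inner_le (p₀ := p₀) hp z
    rw [← hfin, ← EReal.coe_add] at h
    calc ((inner ℝ z p.2 : ℝ) : EReal) - rockafellar Γ p₀ z
        ≤ ((inner ℝ z p.2 : ℝ) : EReal) -
          (((rockafellar Γ p₀ p.1).toReal + inner ℝ (z - p.1) p.2 : ℝ) : EReal) :=
        EReal.sub_le_sub le_rfl h
      _ = _ := by
        rw [← EReal.coe_sub, inner_sub_left]
        congr 1
        ring
  · rw [EReal.coe_sub, hfin]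

theorem inner_le_add_of_conjugate {f : E → EReal} {x y : E} {a b : ℝ}
    (hx : f x = a) (hy : conjugate f y = b) : inner ℝ x y ≤ a + b := by
  have h : ((inner ℝ x y : ℝ) : EReal) - f x ≤ conjugate f y :=
    le_iSup (fun x => ((inner ℝ x y : ℝ) : EReal) - f x) x
  rw [hx, hy, ← EReal.coe_sub, EReal.coe_le_coe_iff] at h
  linarith

/-- Testing the conjugate at the base point gives the affine minorant matching `le_rockafellar`. -/
theorem CyclicallyMonotone.inner_le_conjugate {Γ : Set (E × E)} (hΓ : CyclicallyMonotone Γ)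
    (p₀ : E × E) (y : E) : ((inner ℝ p₀.1 y : ℝ) : EReal) ≤ conjugate (rockafellar Γ p₀) y := by
  refine le_iSup_of_le p₀.1 ?_
  calc ((inner ℝ p₀.1 y : ℝ) : EReal) = ((inner ℝ p₀.1 y : ℝ) : EReal) - 0 := by simp
    _ ≤ _ := EReal.sub_le_sub le_rfl (hΓ.rockafellar_base_le p₀)

theorem lowerSemicontinuous_rockafellar (Γ : Set (E × E)) (p₀ : E × E) :
    LowerSemicontinuous (rockafellar Γ p₀) := by
  refine lowerSemicontinuous_iSup fun n => lowerSemicontinuous_iSup fun q =>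
    lowerSemicontinuous_iSup fun _ => Continuous.lowerSemicontinuous ?_
  exact continuous_coe_real_ereal.comp (by fun_prop)

theorem lowerSemicontinuous_conjugate (f : E → EReal) : LowerSemicontinuous (conjugate f) := by
  refine lowerSemicontinuous_iSup fun x => Continuous.lowerSemicontinuous ?_
  induction h : f x with
  | bot => simpa [sub_eq_add_neg] using continuous_const
  | top => simpa [sub_eq_add_neg] using continuous_const
  | coe a =>
    simp only [← EReal.coe_sub]
    exact continuous_coe_real_ereal.comp (by fun_prop)

/-- Monotonicity under permutations implies cyclical monotonicity. -/
theorem CyclicallyMonotone.of_perm {Γ : Set (E × E)}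
    (h : ∀ (n : ℕ) (p : Fin (n + 1) → E × E), (∀ i, p i ∈ Γ) → ∀ σ : Equiv.Perm (Fin (n + 1)),
      ∑ i, inner ℝ (p (σ i)).1 (p i).2 ≤ ∑ i, inner ℝ (p i).1 (p i).2) :
    CyclicallyMonotone Γ := by
  intro n q hq
  -- The cyclic shift sends the last index to `0`, which produces the closing term of the cycle.
  have := h n (fun i => q i) (fun i => hq i) (finRotate (n + 1))
  rw [← sub_nonpos, ← Finset.sum_sub_distrib] at this
  simp only [← inner_sub_left] at this
  rw [Fin.sum_univ_castSucc] at this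
  rw [← Fin.sum_univ_eq_sum_range (fun i => inner ℝ ((q (i + 1)).1 - (q i).1) (q i).2) n]
  have hs : ∀ i : Fin n, ((finRotate (n + 1) i.castSucc : Fin (n + 1)) : ℕ) = i + 1 := by
    intro i
    rw [coe_finRotate_of_ne_last (Fin.castSucc_lt_last i).ne]
    simp
  simpa [hs, finRotate_last] using this

end Rockafellar

/-! ### Extended integrals -/

section ExtIntegral

variable {X : Type*} [MeasurableSpace X] {μ : Measure X}

/-- Monotonicity of the lower integral needs no measurability, so arbitrary integrands may be
compared, including those with both parts infinite. -/
theorem extIntegral_mono_ae {f g : X → EReal} (h : f ≤ᵐ[μ] g) :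
    extIntegral μ f ≤ extIntegral μ g := by
  refine EReal.sub_le_sub ?_ ?_
  · refine EReal.coe_ennreal_le_coe_ennreal_iff.2 (lintegral_mono_ae ?_)
    filter_upwards [h] with x hx using EReal.toENNReal_le_toENNReal hx
  · refine EReal.coe_ennreal_le_coe_ennreal_iff.2 (lintegral_mono_ae ?_)
    filter_upwards [h] with x hx using
      EReal.toENNReal_le_toENNReal (EReal.neg_le_neg_iff.2 hx)

theorem extIntegral_congr_ae {f g : X → EReal} (h : f =ᵐ[μ] g) :
    extIntegral μ f = extIntegral μ g :=
  le_antisymm (extIntegral_mono_ae h.le) (extIntegral_mono_ae h.symm.le)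

theorem extIntegral_coe {f : X → ℝ} (hf : Integrable f μ) :
    extIntegral μ (fun x => (f x : EReal)) = ((∫ x, f x ∂μ : ℝ) : EReal) := by
  have h1 : ∫⁻ x, ENNReal.ofReal (f x) ∂μ ≠ ⊤ := hf.lintegral_lt_top.ne
  have h2 : ∫⁻ x, ENNReal.ofReal (-f x) ∂μ ≠ ⊤ := hf.neg.lintegral_lt_top.ne
  rw [integral_eq_lintegral_pos_part_sub_lintegral_neg_part hf, EReal.coe_sub]
  simp only [extIntegral, ← EReal.coe_neg, EReal.real_coe_toENNReal]
  rw [EReal.coe_ennreal_toReal h1, EReal.coe_ennreal_toReal h2]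

end ExtIntegral

/-! ### Integrable dual potentials and their approximation -/

section Duality

variable {E : Type*} [NormedAddCommGroup E]

theorem integrable_inner_of_memLp [InnerProductSpace ℝ E] {X : Type*} [MeasurableSpace X]
    {μ : Measure X} {u v : X → E} (hu : MemLp u 2 μ) (hv : MemLp v 2 μ) : Integrable (fun x => inner ℝ (u x) (v x)) μ := by
  refine (hu.integrable_norm_pow (by norm_num)).add (hv.integrable_norm_pow (by norm_num))
    |>.mono' (hu.1.inner hv.1) (ae_of_all _ fun x => ?_)
  have := norm_inner_le_norm (𝕜 := ℝ) (u x) (v x)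
  refine this.trans ?_
  simp only [Pi.add_apply]
  nlinarith [sq_nonneg (‖u x‖ - ‖v x‖), sq_nonneg ‖u x‖, sq_nonneg ‖v x‖]

/-- Dual attainment: if `π` has finite second moments and is concentrated on a cyclically monotone
set, then there are integrable potentials, finite almost everywhere, whose total integral is the
correlation of `π`. -/
theorem exists_dual_potentials [InnerProductSpace ℝ E] [SecondCountableTopology E]
    [MeasurableSpace E] [BorelSpace E] {π : Measure (E × E)} [IsProbabilityMeasure π]
    (h1 : MemLp Prod.fst 2 π) (h2 : MemLp Prod.snd 2 π)
    {Γ : Set (E × E)} (hΓ : CyclicallyMonotone Γ) (hπΓ : ∀ᵐ p ∂π, p ∈ Γ) :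
    ∃ (f g : E → ℝ) (A B : Set E), Measurable g ∧ MeasurableSet B ∧ (∀ᵐ x ∂π.fst, x ∈ A) ∧ (∀ᵐ y ∂π.snd, y ∈ B) ∧
      Integrable f π.fst ∧ Integrable g π.snd ∧
      (∀ x ∈ A, ∀ y ∈ B, inner ℝ x y ≤ f x + g y) ∧
      ∫ x, f x ∂π.fst + ∫ y, g y ∂π.snd = ∫ p, inner ℝ p.1 p.2 ∂π := by
  obtain ⟨p₀, hp₀⟩ := hπΓ.exists
  set F := rockafellar Γ p₀ with hF
  set G := conjugate F with hG
  have hFm : Measurable F := (lowerSemicontinuous_rockafellar Γ p₀).measurable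
  have hGm : Measurable G := (lowerSemicontinuous_conjugate F).measurable
  have hFbot : ∀ x, F x ≠ ⊥ := rockafellar_ne_bot hp₀
  have hGlow : ∀ y, ((inner ℝ p₀.1 y : ℝ) : EReal) ≤ G y := hΓ.inner_le_conjugate p₀
  have hGbot : ∀ y, G y ≠ ⊥ := fun y => ne_bot_of_le_ne_bot (EReal.coe_ne_bot _) (hGlow y)
  have hA : MeasurableSet {x | F x ≠ ⊤} := (hFm (measurableSet_singleton ⊤)).compl
  have hB : MeasurableSet {y | G y ≠ ⊤} := (hGm (measurableSet_singleton ⊤)).compl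
  have hFA : ∀ᵐ p ∂π, F p.1 ≠ ⊤ := by
    filter_upwards [hπΓ] with p hp using hΓ.rockafellar_ne_top hp
  have hGB : ∀ᵐ p ∂π, G p.2 ≠ ⊤ := by
    filter_upwards [hπΓ] with p hp
    rw [hG, hF, hΓ.conjugate_rockafellar hp₀ hp]
    exact EReal.coe_ne_top _
  have heq : ∀ᵐ p ∂π, (F p.1).toReal + (G p.2).toReal = inner ℝ p.1 p.2 := by
    filter_upwards [hπΓ] with p hp
    rw [hG, hF, hΓ.conjugate_rockafellar hp₀ hp, EReal.toReal_coe]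
    ring
  have hFlow : ∀ᵐ p ∂π, inner ℝ (p.1 - p₀.1) p₀.2 ≤ (F p.1).toReal := by
    filter_upwards [hFA] with p hp
    have := le_rockafellar hp₀ p.1
    rwa [← hF, ← EReal.coe_toReal hp (hFbot _), EReal.coe_le_coe_iff] at this
  have hGlow' : ∀ᵐ p ∂π, inner ℝ p₀.1 p.2 ≤ (G p.2).toReal := by
    filter_upwards [hGB] with p hp
    have := hGlow p.2
    rwa [← EReal.coe_toReal hp (hGbot _), EReal.coe_le_coe_iff] at this
  have hinner : Integrable (fun p : E × E => inner ℝ p.1 p.2) π := integrable_inner_of_memLp h1 h2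
  -- `F` is squeezed: its affine minorant lies below, and by the Fenchel–Young equality the minorant
  -- of `G` bounds it above.
  have hFint : Integrable (fun p : E × E => (F p.1).toReal) π := by
    refine integrable_of_le_of_le (hFm.ereal_toReal.comp measurable_fst).aestronglyMeasurable
      hFlow ?_ (integrable_inner_of_memLp (h1.sub (memLp_const p₀.1)) (memLp_const p₀.2))
      (hinner.sub (integrable_inner_of_memLp (memLp_const p₀.1) h2))
    filter_upwards [heq, hGlow'] with p hp1 hp2
    simp only [Pi.sub_apply]
    linarith
  have hGint : Integrable (fun p : E × E => (G p.2).toReal) π := by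
    refine (hinner.sub hFint).congr ?_
    filter_upwards [heq] with p hp
    simp only [Pi.sub_apply]
    linarith
  have hFs : AEStronglyMeasurable (fun x => (F x).toReal) π.fst :=
    hFm.ereal_toReal.aestronglyMeasurable
  have hGs : AEStronglyMeasurable (fun x => (G x).toReal) π.snd :=
    hGm.ereal_toReal.aestronglyMeasurable
  -- Since `toReal` sends `⊤` to `0`, the Fenchel–Young inequality survives only where both
  -- potentials are finite; hence `A` and `B`.
  refine ⟨fun x => (F x).toReal, fun y => (G y).toReal, {x | F x ≠ ⊤}, {y | G y ≠ ⊤},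
    hGm.ereal_toReal, hB, ?_, ?_, ?_, ?_, ?_, ?_⟩
  · exact (ae_map_iff measurable_fst.aemeasurable hA).2 hFA
  · exact (ae_map_iff measurable_snd.aemeasurable hB).2 hGB
  · exact (integrable_map_measure hFs measurable_fst.aemeasurable).2 hFint
  · exact (integrable_map_measure hGs measurable_snd.aemeasurable).2 hGint
  · intro x hx y hy
    exact inner_le_add_of_conjugate (EReal.coe_toReal hx (hFbot x)).symm
      (EReal.coe_toReal hy (hGbot y)).symm
  · rw [Measure.fst, Measure.snd, integral_map measurable_fst.aemeasurable hFs,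
      integral_map measurable_snd.aemeasurable hGs, ← integral_add hFint hGint]
    exact integral_congr_ae heq

/-- Young's inequality with a parameter. -/
theorem inner_le_young [InnerProductSpace ℝ E] (x y : E) {k : ℝ} (hk : 0 < k) :
    inner ℝ x y ≤ ‖x‖ ^ 2 / (4 * k) + k * ‖y‖ ^ 2 := by
  have h := real_inner_le_norm x y
  have h3 : ‖x‖ * ‖y‖ ≤ ‖x‖ ^ 2 / (4 * k) + k * ‖y‖ ^ 2 := by
    have : ‖x‖ ^ 2 / (4 * k) + k * ‖y‖ ^ 2 - ‖x‖ * ‖y‖ = (‖x‖ - 2 * k * ‖y‖) ^ 2 / (4 * k) := by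
      field_simp
      ring
    have h4 : 0 ≤ (‖x‖ - 2 * k * ‖y‖) ^ 2 / (4 * k) := by positivity
    linarith
  exact h.trans h3

/-- With `k = n + 1`, the maximum bounds the conjugate of a potential modified to `k‖y‖² + k` on a
null set. At each `x` the second entry tends to `-∞`, so the maximum is eventually `f x`; `|f x| +
‖x‖²` dominates throughout. -/
theorem tendsto_integral_max_sub [SecondCountableTopology E]
    [MeasurableSpace E] [BorelSpace E] {P : Measure E} {f : E → ℝ} (hf : Integrable f P)
    (hP : MemLp id 2 P) :
    (∀ n : ℕ, Integrable (fun x => max (f x) (‖x‖ ^ 2 / (4 * (n + 1 : ℝ)) - (n + 1))) P) ∧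
    Tendsto (fun n : ℕ => ∫ x, max (f x) (‖x‖ ^ 2 / (4 * (n + 1 : ℝ)) - (n + 1)) ∂P) atTop
      (𝓝 (∫ x, f x ∂P)) := by
  have hsq : Integrable (fun x : E => ‖x‖ ^ 2) P := hP.integrable_norm_pow (by norm_num)
  have hbound : ∀ (n : ℕ) (x : E),
      ‖max (f x) (‖x‖ ^ 2 / (4 * (n + 1 : ℝ)) - (n + 1))‖ ≤ |f x| + ‖x‖ ^ 2 := by
    intro n x
    have hn : (0 : ℝ) ≤ n := n.cast_nonneg
    have hq : ‖x‖ ^ 2 / (4 * (n + 1 : ℝ)) ≤ ‖x‖ ^ 2 :=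
      div_le_self (sq_nonneg _) (by linarith)
    rw [Real.norm_eq_abs, abs_le]
    constructor
    · have := le_max_left (f x) (‖x‖ ^ 2 / (4 * (n + 1 : ℝ)) - (n + 1))
      linarith [neg_abs_le (f x), sq_nonneg ‖x‖]
    · exact max_le (by linarith [le_abs_self (f x), sq_nonneg ‖x‖])
        (by linarith [abs_nonneg (f x)])
  have hmeas : ∀ n : ℕ, AEStronglyMeasurable
      (fun x => max (f x) (‖x‖ ^ 2 / (4 * (n + 1 : ℝ)) - (n + 1))) P := fun n =>
    hf.1.sup (by fun_prop)
  refine ⟨fun n => (hf.abs.add hsq).mono' (hmeas n) (ae_of_all _ (hbound n)),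
    tendsto_integral_of_dominated_convergence _ hmeas (hf.abs.add hsq)
      (fun n => ae_of_all _ (hbound n)) (ae_of_all _ fun x => ?_)⟩
  refine tendsto_const_nhds.congr' ?_
  filter_upwards [eventually_ge_atTop ⌈‖x‖ ^ 2 + |f x|⌉₊] with n hn
  have hn' : ‖x‖ ^ 2 + |f x| ≤ n := (Nat.le_ceil _).trans (by exact_mod_cast hn)
  have hn0 : (0 : ℝ) ≤ n := n.cast_nonneg
  have hq : ‖x‖ ^ 2 / (4 * (n + 1 : ℝ)) ≤ ‖x‖ ^ 2 := div_le_self (sq_nonneg _) (by linarith)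
  exact (max_eq_left (by linarith [neg_abs_le (f x)])).symm

end Duality

/-! ### The quadratic cost -/

section Quadratic

variable {D : ℕ}

theorem lintegral_quadraticCost_ne_top
    {π : Measure (EuclideanSpace ℝ (Fin D) × EuclideanSpace ℝ (Fin D))}
    (h1 : MemLp Prod.fst 2 π) (h2 : MemLp Prod.snd 2 π) :
    ∫⁻ p, quadraticCost p.1 p.2 ∂π ≠ ⊤ :=
  (((h1.sub h2).integrable_norm_pow (by norm_num)).const_mul (1 / 2)).lintegral_lt_top.ne

/-- The support of an optimal plan for the quadratic cost is cyclically monotone. -/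
theorem IsOTPlan.cyclicallyMonotone_support {P ν : Measure (EuclideanSpace ℝ (Fin D))}
    {π : Measure (EuclideanSpace ℝ (Fin D) × EuclideanSpace ℝ (Fin D))} [IsFiniteMeasure π]
    (hπ : IsOTPlan quadraticCost P ν π) (h1 : MemLp Prod.fst 2 π) (h2 : MemLp Prod.snd 2 π) :
    CyclicallyMonotone π.support := by
  refine CyclicallyMonotone.of_perm fun n p hp σ => ?_
  have hc : Continuous fun p : EuclideanSpace ℝ (Fin D) × EuclideanSpace ℝ (Fin D) =>
      quadraticCost p.1 p.2 := by
    unfold quadraticCost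
    exact ENNReal.continuous_ofReal.comp (by fun_prop)
  have h := hπ.sum_le_sum_perm hc (fun _ _ => ENNReal.ofReal_ne_top)
    (lintegral_quadraticCost_ne_top h1 h2) p hp σ
  unfold quadraticCost at h
  rw [← ENNReal.ofReal_sum_of_nonneg fun i _ => by positivity,
    ← ENNReal.ofReal_sum_of_nonneg fun i _ => by positivity,
    ENNReal.ofReal_le_ofReal_iff (Finset.sum_nonneg fun i _ => by positivity)] at h
  -- A permutation does not change the sums of squared norms, so only the inner products remain to
  -- be compared.
  simp only [norm_sub_sq_real, mul_add, mul_sub, Finset.sum_add_distrib,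
    Finset.sum_sub_distrib] at h
  rw [Equiv.sum_comp σ fun i => 1 / 2 * ‖(p i).1‖ ^ 2] at h
  simp only [← Finset.mul_sum] at h
  linarith

end Quadratic

/-! ### Optimal maps for the embedded cost -/

section MongeMap

variable {H D : ℕ} {μ : Measure (EuclideanSpace ℝ (Fin H))}
  {ν : Measure (EuclideanSpace ℝ (Fin D))}
  {Q G : EuclideanSpace ℝ (Fin H) → EuclideanSpace ℝ (Fin D)}

theorem map_prodMk_mem_couplings (hQ : Measurable Q) (hG : Measurable G) (hGν : μ.map G = ν) :
    μ.map (fun x => (Q x, G x)) ∈ couplings (μ.map Q) ν :=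
  ⟨Measure.fst_map_prodMk hG, by rw [Measure.snd_map_prodMk hQ, hGν]⟩

theorem lintegral_quadraticCost_map_prodMk (hQ : Measurable Q) (hG : Measurable G) :
    ∫⁻ p, quadraticCost p.1 p.2 ∂(μ.map fun x => (Q x, G x)) =
      ∫⁻ x, embeddedQuadraticCost Q x (G x) ∂μ := by
  rw [lintegral_map _ (hQ.prodMk hG)]
  · rfl
  · unfold quadraticCost
    fun_prop

/-- Composing a deterministic optimal plan with the embedding gives an optimal map for the embedded
cost, which is unique if the optimal plan is. -/
theorem isOTMap_comp {T : EuclideanSpace ℝ (Fin D) → EuclideanSpace ℝ (Fin D)}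
    (hQ : Measurable Q) (hT : Measurable T)
    (hplan : IsOTPlan quadraticCost (μ.map Q) ν ((μ.map Q).map fun y => (y, T y)))
    (huniq : ∀ π, IsOTPlan quadraticCost (μ.map Q) ν π → π = (μ.map Q).map fun y => (y, T y)) :
    IsOTMap (embeddedQuadraticCost Q) μ ν (T ∘ Q) ∧
      ∀ G, IsOTMap (embeddedQuadraticCost Q) μ ν G → G =ᵐ[μ] T ∘ Q := by
  have hTQ : Measurable (T ∘ Q) := hT.comp hQ
  have hgraph : (μ.map Q).map (fun y => (y, T y)) = μ.map fun x => (Q x, (T ∘ Q) x) := by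
    rw [Measure.map_map (by fun_prop) hQ]
    rfl
  have hpush : μ.map (T ∘ Q) = ν := by
    rw [← hplan.1.2, hgraph, Measure.snd_map_prodMk hQ]
  have hopt : IsOTMap (embeddedQuadraticCost Q) μ ν (T ∘ Q) := by
    refine ⟨⟨hTQ, hpush⟩, fun S hS hSν => ?_⟩
    have h := hplan.2 _ (map_prodMk_mem_couplings hQ hS hSν)
    rwa [hgraph, lintegral_quadraticCost_map_prodMk hQ hTQ,
      lintegral_quadraticCost_map_prodMk hQ hS] at h
  refine ⟨hopt, fun G hG => ?_⟩
  have hGplan : IsOTPlan quadraticCost (μ.map Q) ν (μ.map fun x => (Q x, G x)) := by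
    refine ⟨map_prodMk_mem_couplings hQ hG.1.1 hG.1.2, fun π' hπ' => ?_⟩
    refine le_trans ?_ (hplan.2 π' hπ')
    rw [hgraph, lintegral_quadraticCost_map_prodMk hQ hTQ,
      lintegral_quadraticCost_map_prodMk hQ hG.1.1]
    exact hG.2 _ hTQ hpush
  have hset : MeasurableSet {p : EuclideanSpace ℝ (Fin D) × EuclideanSpace ℝ (Fin D) |
      p.2 = T p.1} := measurableSet_eq_fun measurable_snd (hT.comp measurable_fst)
  have hae : ∀ᵐ p ∂(μ.map fun x => (Q x, G x)), p.2 = T p.1 := by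
    rw [huniq _ hGplan, ae_map_iff (by fun_prop) hset]
    exact ae_of_all _ fun _ => rfl
  exact (ae_map_iff (hQ.prodMk hG.1.1).aemeasurable hset).1 hae

end MongeMap

/-! ### Bounds for the saddle point problem -/

section SaddlePoint

variable {H D : ℕ} {μ : Measure (EuclideanSpace ℝ (Fin H))}
  {ν : Measure (EuclideanSpace ℝ (Fin D))}
  {Q : EuclideanSpace ℝ (Fin H) → EuclideanSpace ℝ (Fin D)}
  {ψ : EuclideanSpace ℝ (Fin D) → EReal}

theorem IsPotential.ae_coe_toReal (hψ : IsPotential ν ψ) :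
    ∀ᵐ y ∂ν, ((ψ y).toReal : EReal) = ψ y := by
  have hm : Measurable fun y => (ψ y).abs := by
    refine (EReal.measurable_of_measurable_real (f := EReal.abs) ?_).comp hψ.1
    simp only [EReal.abs_def]
    fun_prop
  filter_upwards [ae_lt_top hm hψ.2.2] with y hy
  refine EReal.coe_toReal (fun h => ?_) (hψ.2.1 y)
  simp [h] at hy

theorem IsPotential.integrable_toReal (hψ : IsPotential ν ψ) :
    Integrable (fun y => (ψ y).toReal) ν := by
  refine ⟨hψ.1.ereal_toReal.aestronglyMeasurable, lt_of_le_of_lt ?_ hψ.2.2.lt_top⟩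
  refine lintegral_mono_ae ?_
  filter_upwards [hψ.ae_coe_toReal] with y hy
  rw [← hy, EReal.toReal_coe, EReal.abs_def, ← ofReal_norm, Real.norm_eq_abs]

theorem isPotential_coe {φ : EuclideanSpace ℝ (Fin D) → ℝ} (hφ : Measurable φ)
    (hint : Integrable φ ν) : IsPotential ν fun y => (φ y : EReal) := by
  refine ⟨hφ.coe_real_ereal, fun y => EReal.coe_ne_bot _, ?_⟩
  have h := hint.2.ne
  simpa only [EReal.abs_def, ← ofReal_norm, Real.norm_eq_abs] using h

/-- If the conjugate of a real-valued potential is bounded by an integrable function `h`, then the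
outer objective is at most `∫ h + ∫ φ`. -/
theorem outerObjective_coe_le (hQ : Measurable Q)
    {φ h : EuclideanSpace ℝ (Fin D) → ℝ} (hφ : Integrable φ ν) (hh : Integrable h (μ.map Q))
    (hle : ∀ᵐ x ∂(μ.map Q), ∀ y, inner ℝ x y - φ y ≤ h x) :
    outerObjective Q μ ν (fun y => (φ y : EReal)) ≤
      ((∫ x, h x ∂(μ.map Q) + ∫ y, φ y ∂ν : ℝ) : EReal) := by
  refine iSup₂_le fun G _ => ?_
  rw [extIntegral_coe hφ, EReal.coe_add]
  refine add_le_add ?_ le_rfl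
  rw [integral_map hQ.aemeasurable hh.1, ← extIntegral_coe (f := fun x => h (Q x))
    (hh.comp_measurable hQ)]
  refine extIntegral_mono_ae ?_
  filter_upwards [ae_of_ae_map hQ.aemeasurable hle] with x hx
  rw [← EReal.coe_sub, EReal.coe_le_coe_iff]
  exact hx _

/-- Weak duality for optimal potentials: almost everywhere finite dual potentials bound the
objective at an optimal potential. They need not be finite everywhere, since they may be modified
on a null set by quadratics of arbitrarily large slope. -/
theorem IsOptimalPotential.outerObjective_le (hψ : IsOptimalPotential Q μ ν ψ)
    (hQ : Measurable Q) (hQμ : MemLp id 2 (μ.map Q))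
    {f g : EuclideanSpace ℝ (Fin D) → ℝ} {A B : Set (EuclideanSpace ℝ (Fin D))}
    (hg : Measurable g) (hB : MeasurableSet B)
    (hA' : ∀ᵐ x ∂(μ.map Q), x ∈ A) (hB' : ∀ᵐ y ∂ν, y ∈ B)
    (hfi : Integrable f (μ.map Q)) (hgi : Integrable g ν)
    (hfg : ∀ x ∈ A, ∀ y ∈ B, inner ℝ x y ≤ f x + g y) :
    outerObjective Q μ ν ψ ≤ ((∫ x, f x ∂(μ.map Q) + ∫ y, g y ∂ν : ℝ) : EReal) := by
  classical
  obtain ⟨hint, htend⟩ := tendsto_integral_max_sub hfi hQμ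
  have hn : ∀ n : ℕ, outerObjective Q μ ν ψ ≤
      ((∫ x, max (f x) (‖x‖ ^ 2 / (4 * (n + 1 : ℝ)) - (n + 1)) ∂(μ.map Q) +
        ∫ y, g y ∂ν : ℝ) : EReal) := by
    intro n
    -- Off `B`, Young's inequality with `k = n + 1` gives `⟪x, y⟫ - φ y ≤ ‖x‖² / (4k) - k`; the
    -- added constant drives this bound to `-∞`.
    set φ : EuclideanSpace ℝ (Fin D) → ℝ :=
      B.piecewise g fun y => (n + 1 : ℝ) * ‖y‖ ^ 2 + (n + 1) with hφ
    have hφm : Measurable φ := hg.piecewise hB (by fun_prop)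
    have hφg : φ =ᵐ[ν] g := by
      filter_upwards [hB'] with y hy
      simp [hφ, hy]
    have hφi : Integrable φ ν := hgi.congr hφg.symm
    refine (hψ.2 φ (isPotential_coe hφm hφi)).trans ?_
    rw [← integral_congr_ae hφg]
    refine outerObjective_coe_le hQ hφi (hint n) ?_
    filter_upwards [hA'] with x hx y
    by_cases hy : y ∈ B
    · refine le_max_of_le_left ?_
      have := hfg x hx y hy
      simp only [hφ, Set.piecewise_eq_of_mem _ _ _ hy]
      linarith
    · refine le_max_of_le_right ?_
      have := inner_le_young x y (k := (n + 1 : ℝ)) (by positivity)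
      simp only [hφ, Set.piecewise_eq_of_notMem _ _ _ hy]
      linarith
  exact ge_of_tendsto' ((continuous_coe_real_ereal.tendsto _).comp
    (htend.add tendsto_const_nhds)) hn

/-- The inner functional at a map that transports `μ` to `ν` with finite correlation. -/
theorem innerFunctional_of_map_eq {G : EuclideanSpace ℝ (Fin H) → EuclideanSpace ℝ (Fin D)}
    (hψ : IsPotential ν ψ) (hG : Measurable G) (hGν : μ.map G = ν)
    (hint : Integrable (fun x => inner ℝ (Q x) (G x)) μ) :
    innerFunctional Q μ ψ G =
      ((∫ x, inner ℝ (Q x) (G x) ∂μ - ∫ y, (ψ y).toReal ∂ν : ℝ) : EReal) := by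
  subst hGν
  have hψG : Integrable (fun x => (ψ (G x)).toReal) μ :=
    hψ.integrable_toReal.comp_measurable hG
  rw [integral_map hG.aemeasurable hψ.integrable_toReal.1, ← integral_sub hint hψG,
    ← extIntegral_coe (f := fun x => inner ℝ (Q x) (G x) - (ψ (G x)).toReal) (hint.sub hψG)]
  refine extIntegral_congr_ae ?_
  filter_upwards [ae_of_ae_map hG.aemeasurable hψ.ae_coe_toReal] with x hx
  rw [EReal.coe_sub, hx]

end SaddlePoint
end EmbeddedOT

/-! ### The embedded transport map and the saddle point problem -/

theorem lemma4p2 {H D : ℕ}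
    (μ : Measure (EuclideanSpace ℝ (Fin H))) [IsProbabilityMeasure μ]
    (ν : Measure (EuclideanSpace ℝ (Fin D))) [IsProbabilityMeasure ν]
    (Q : EuclideanSpace ℝ (Fin H) → EuclideanSpace ℝ (Fin D)) (hQ : Measurable Q)
    (hQμ : MemLp id 2 (μ.map Q)) (hν : MemLp id 2 ν)
    (T : EuclideanSpace ℝ (Fin D) → EuclideanSpace ℝ (Fin D)) (hT : Measurable T)
    (hplan : EmbeddedOT.IsOTPlan EmbeddedOT.quadraticCost (μ.map Q) ν
      ((μ.map Q).map fun y => (y, T y)))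
    (huniq : ∀ π, EmbeddedOT.IsOTPlan EmbeddedOT.quadraticCost (μ.map Q) ν π →
      π = (μ.map Q).map fun y => (y, T y)) :
    (EmbeddedOT.IsOTMap (EmbeddedOT.embeddedQuadraticCost Q) μ ν (T ∘ Q) ∧
      ∀ G, EmbeddedOT.IsOTMap (EmbeddedOT.embeddedQuadraticCost Q) μ ν G → G =ᵐ[μ] T ∘ Q) ∧
    ∀ ψ : EuclideanSpace ℝ (Fin D) → EReal, EmbeddedOT.IsOptimalPotential Q μ ν ψ →
      (EmbeddedOT.innerFunctional Q μ ψ (T ∘ Q) ≠ ⊥ ∧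
        EmbeddedOT.innerFunctional Q μ ψ (T ∘ Q) ≠ ⊤) ∧
      ∀ G : EuclideanSpace ℝ (Fin H) → EuclideanSpace ℝ (Fin D), Measurable G →
        EmbeddedOT.innerFunctional Q μ ψ G ≤ EmbeddedOT.innerFunctional Q μ ψ (T ∘ Q) := by
  have hmap := EmbeddedOT.isOTMap_comp hQ hT hplan huniq
  refine ⟨hmap, fun ψ hψ => ?_⟩
  have hTQ : Measurable (T ∘ Q) := hT.comp hQ
  have hpush : μ.map (T ∘ Q) = ν := hmap.1.1.2
  set π := (μ.map Q).map fun y => (y, T y) with hπ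
  have hgraph : π = μ.map fun x => (Q x, (T ∘ Q) x) := by
    rw [hπ, Measure.map_map (by fun_prop) hQ]
    rfl
  have : IsProbabilityMeasure π := by
    rw [hgraph]
    exact Measure.isProbabilityMeasure_map (hQ.prodMk hTQ).aemeasurable
  have h1 : MemLp Prod.fst 2 π := by
    have h := hQμ
    rw [← hplan.1.1] at h
    exact h.comp_of_map measurable_fst.aemeasurable
  have h2 : MemLp Prod.snd 2 π := by
    have h := hν
    rw [← hplan.1.2] at h
    exact h.comp_of_map measurable_snd.aemeasurable
  obtain ⟨f, g, A, B, hg, hB, hA', hB', hfi, hgi, hfg, heq⟩ :=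
    EmbeddedOT.exists_dual_potentials h1 h2 (hplan.cyclicallyMonotone_support h1 h2)
      Measure.support_mem_ae
  rw [hplan.1.1] at hA' hfi heq
  rw [hplan.1.2] at hB' hgi heq
  have hle := hψ.outerObjective_le hQ hQμ hg hB hA' hB' hfi hgi hfg
  have hinner : Integrable (fun x => inner ℝ (Q x) ((T ∘ Q) x)) μ := by
    have h := EmbeddedOT.integrable_inner_of_memLp h1 h2
    rw [hgraph] at h
    exact h.comp_measurable (hQ.prodMk hTQ)
  have hcorr : ∫ p, inner ℝ p.1 p.2 ∂π = ∫ x, inner ℝ (Q x) ((T ∘ Q) x) ∂μ := by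
    rw [hgraph, integral_map (hQ.prodMk hTQ).aemeasurable (by fun_prop)]
  have hval := EmbeddedOT.innerFunctional_of_map_eq hψ.1 hTQ hpush hinner
  have hψν : EmbeddedOT.extIntegral ν ψ = ((∫ y, (ψ y).toReal ∂ν : ℝ) : EReal) := by
    rw [← EmbeddedOT.extIntegral_coe hψ.1.integrable_toReal]
    exact EmbeddedOT.extIntegral_congr_ae (hψ.1.ae_coe_toReal.mono fun y hy => hy.symm)
  refine ⟨by rw [hval]; exact ⟨EReal.coe_ne_bot _, EReal.coe_ne_top _⟩, fun G hG => ?_⟩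
  -- For every `G` the inner functional plus `∫ ψ dν` is at most the dual value, which is the
  -- correlation of `Q` and `T ∘ Q`; subtracting the finite `∫ ψ dν` leaves the value at `T ∘ Q`.
  have hG' := (le_iSup₂ (f := fun (G : EuclideanSpace ℝ (Fin H) → EuclideanSpace ℝ (Fin D))
    (_ : Measurable G) => EmbeddedOT.innerFunctional Q μ ψ G + EmbeddedOT.extIntegral ν ψ)
    G hG).trans hle
  rw [heq, hcorr, hψν] at hG'
  rw [hval, EReal.coe_sub]
  exact EReal.le_sub_iff_add_le (Or.inl (EReal.coe_ne_bot _)) (Or.inl (EReal.coe_ne_top _)) |>.2 hG'
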